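/- An ascent in a sequence $x_1x_2\cdots x_k$ of non-negative integers is a place $j\ge 1$ with $x_j<x_{j+1}$; let $\mathrm{asc}(x_1\cdots x_k)$ be the number of ascents. An ascent sequence of length $n$ is a sequence $x_1x_2\cdots x_n$ of non-negative integers with $x_1=0$ and $x_i\le \mathrm{asc}(x_1x_2\cdots x_{i-1})+1$ for all $1<i\le n$. It avoids the pattern $1012$ if it has no subsequence that is order isomorphic to $1012$, i.e. if there are no positions $i_1<i_2<i_3<i_4$ with $x_{i_2}<x_{i_1}=x_{i_3}<x_{i_4}$. Let $A_{1012}(n)$ be the number of ascent sequences of length $n$ that avoid $1012$, and let $C_i=\frac{1}{i+1}\binom{2i}{i}$ be the $i$-th Catalan number. Theorem. For all $n\ge 1$, $$A_{1012}(n)=\sum_{i=0}^{n-1}\binom{n-1}{i}C_i .$$ Equivalently, as formal power series in $t$ over $\mathbb{Q}$, $$\sum_{n\ge 1}A_{1012}(n)\,t^n=\frac12\left(1-\sqrt{\frac{1-5t}{1-t}}\right),$$ where the square root is the power series with constant term $1$ whose square is $\frac{1-5t}{1-t}$. -/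

import Mathlib

namespace AscentSeq

/-- The number of ascents of a finite sequence `x₁x₂⋯x_k` of non-negative integers, i.e. the
number of places `j ≥ 1` such that `x_j < x_{j+1}`. -/
def asc : List ℕ → ℕ
  | [] => 0
  | [_] => 0
  | a :: b :: l => (if a < b then 1 else 0) + asc (b :: l)

/-- A sequence `x₁x₂⋯x_n` of non-negative integers is an ascent sequence if `x₁ = 0` and
`x_i ≤ asc(x₁x₂⋯x_{i-1}) + 1` for `1 < i ≤ n`.  (List positions start at `0`, so the entry at
position `i` is preceded by the first `i` entries, `x.take i`.) -/
def IsAscentSeq (x : List ℕ) : Prop :=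
  (∀ h : 0 < x.length, x[0] = 0) ∧
    ∀ (i : ℕ) (h : i < x.length), 0 < i → x[i] ≤ asc (x.take i) + 1

/-- `x` contains the pattern `τ` if some subsequence of `x` is order isomorphic to `τ`. -/
def Contains (x τ : List ℕ) : Prop :=
  ∃ f : Fin τ.length → Fin x.length, StrictMono f ∧
    ∀ i j : Fin τ.length,
      (x.get (f i) < x.get (f j) ↔ τ.get i < τ.get j) ∧
      (x.get (f i) > x.get (f j) ↔ τ.get i > τ.get j)

/-- The set of ascent sequences of length `n` that avoid the pattern `τ`. -/
def avoiders (τ : List ℕ) (n : ℕ) : Set (List ℕ) :=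
  {x | x.length = n ∧ IsAscentSeq x ∧ ¬ Contains x τ}

/-- The number of ascent sequences of length `n` that avoid the pattern `τ`. -/
noncomputable def numAvoiders (τ : List ℕ) (n : ℕ) : ℕ := (avoiders τ n).ncard

/-- The generating function `∑_{n ≥ 1} A_τ(n) tⁿ` (no constant term), as a formal power series. -/
noncomputable def genFun (τ : List ℕ) : PowerSeries ℚ :=
  PowerSeries.mk fun n => if n = 0 then 0 else (numAvoiders τ n : ℚ)

/-- `S` is the formal power series `√F`, for `F` with constant term `1`: the (unique) power
series with constant term `1` whose square is `F`. -/
def IsSqrt (S F : PowerSeries ℚ) : Prop :=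
  PowerSeries.constantCoeff S = 1 ∧ S ^ 2 = F

end AscentSeq

namespace AscentSeq

/-! Among words avoiding 1012, ascent sequences and restricted growth words coincide
(`isAscentSeq_iff_grow`): while no 101 has occurred, every ascent sets a new maximum, and once a 101
has occurred, a letter above the maximum would complete a 1012.

Cut a nonempty word of this kind at its last 0, as L 0 A' D. Here A' uses only letters new to L, and
D is weakly decreasing in the positive letters of L, since d in L, then 0, then d < e would be a
1012. If A' is nonempty, L must avoid 101; if A' is empty, the letters of D are bounded by `stat L`,
because a larger letter would extend some 101 in L. These conditions also suffice (`exists_build`,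
`av_build_of_nc`, `av_build_of_tail_stat`), and `stat` of the whole word can be read off from the
pieces.

Let F(v) sum X^length * v^stat over these words, let N(v) be its analogue for 101-avoiders with v
marking the largest letter, and put y = 1/(1-X), z = X/(1-X). The decomposition gives a quadratic
equation for N (`ncGen_eq`) and a linear one relating F(v), F(y) and F(1) (`avGen_eq`). With c = 1 +
z c^2, the value v = 1 + z c annihilates the coefficient of F(v); together with the equation at v =
1 this yields F(1) = z c (`avGen_one`). Since c is the Catalan series at z, expanding powers of z
gives the binomial sum, and completing the square in the equation for c gives the square root. -/

/-- One more than the largest letter of a word, and `0` for the empty word. -/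
def bound : List ℕ → ℕ
  | [] => 0
  | a :: l => max (a + 1) (bound l)

/-- Every letter is at most `m`, or at most one more than the largest letter before it. -/
def Grow : ℕ → List ℕ → Prop
  | _, [] => True
  | m, a :: l => a ≤ m ∧ Grow (max m (a + 1)) l

/-- The letter `a` occurs twice with a smaller letter in between. -/
def Hit (w : List ℕ) (a : ℕ) : Prop := ∃ b < a, [a, b, a].Sublist w

/-- Avoidance of `1012`. -/
def Av (w : List ℕ) : Prop := ∀ a b c, b < a → a < c → ¬ [a, b, a, c].Sublist w

/-- Avoidance of `101`. -/
def Nc (w : List ℕ) : Prop := ∀ a, ¬ Hit w a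

open Classical in
/-- The largest letter of the word that exceeds no letter `a` with `Hit w a`. -/
noncomputable def stat (w : List ℕ) : ℕ :=
  Nat.findGreatest (fun c => ∀ a < c, ¬ Hit w a) (bound w - 1)

/-! ### Largest letters and restricted growth -/

@[simp] theorem bound_nil : bound [] = 0 := rfl

@[simp] theorem bound_cons (a : ℕ) (l : List ℕ) : bound (a :: l) = max (a + 1) (bound l) := rfl

@[simp] theorem bound_append (u v : List ℕ) : bound (u ++ v) = max (bound u) (bound v) := by
  induction u with
  | nil => simp
  | cons a u ih => simp [ih, max_assoc]

theorem bound_le_iff {w : List ℕ} {m : ℕ} : bound w ≤ m ↔ ∀ a ∈ w, a < m := by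
  induction w with
  | nil => simp
  | cons a u ih => simp [ih]

theorem lt_bound {w : List ℕ} {a : ℕ} (h : a ∈ w) : a < bound w := bound_le_iff.1 le_rfl a h

theorem bound_map_add {w : List ℕ} (hw : w ≠ []) (s : ℕ) :
    bound (w.map (· + s)) = bound w + s := by
  induction w with
  | nil => exact absurd rfl hw
  | cons a u ih =>
    rcases eq_or_ne u [] with rfl | hu
    · simp; omega
    · simp [ih hu]; omega

theorem grow_append {m : ℕ} {u v : List ℕ} :
    Grow m (u ++ v) ↔ Grow m u ∧ Grow (max m (bound u)) v := by
  induction u generalizing m with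
  | nil => simp [Grow]
  | cons a u ih => simp [Grow, ih, and_assoc, max_assoc]

theorem grow_map_add {m s : ℕ} {w : List ℕ} : Grow (m + s) (w.map (· + s)) ↔ Grow m w := by
  induction w generalizing m with
  | nil => simp [Grow]
  | cons a u ih =>
    have : max (m + s) (a + s + 1) = max m (a + 1) + s := by omega
    simp [Grow, this, ih]

theorem grow_of_forall_le {m : ℕ} {w : List ℕ} (h : ∀ a ∈ w, a ≤ m) : Grow m w := by
  induction w generalizing m with
  | nil => trivial
  | cons a u ih =>
    simp only [List.mem_cons, forall_eq_or_imp] at h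
    exact ⟨h.1, ih fun b hb => (h.2 b hb).trans (le_max_left _ _)⟩

/-- The maximum can rise past `m` only one step at a time, so no value is skipped. With `m = 0`,
every value below the bound occurs. -/
theorem mem_of_grow {w : List ℕ} {m a : ℕ} (h : Grow m w) (h1 : m ≤ a) (h2 : a < bound w) :
    a ∈ w := by
  induction w generalizing m with
  | nil => simp at h2
  | cons b u ih =>
    obtain ⟨hb, hu⟩ := h
    by_cases hab : a = b
    · simp [hab]
    · refine List.mem_cons_of_mem _ (ih hu ?_ ?_) <;> simp at * <;> omega

theorem bound_pos {w : List ℕ} (h : w ≠ []) : 0 < bound w := by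
  cases w with
  | nil => exact absurd rfl h
  | cons a u => simp

theorem bound_le_length {w : List ℕ} {m : ℕ} (h : Grow m w) : bound w ≤ m + w.length := by
  induction w generalizing m with
  | nil => simp
  | cons a u ih =>
    have := ih h.2
    have := h.1
    rcases le_total m (a + 1) with h | h <;> simp_all <;> omega

/-! ### Sublists of concatenations -/

theorem sublist_append_right_of_not_mem {l u v : List ℕ} {a : ℕ} (h : (a :: l).Sublist (u ++ v))
    (ha : a ∉ u) : (a :: l).Sublist v := by
  induction u with
  | nil => simpa using h
  | cons b u ih =>
    simp only [List.mem_cons, not_or] at ha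
    rcases List.sublist_cons_iff.1 h with h | ⟨r, hr, _⟩
    · exact ih h ha.2
    · exact absurd (List.cons.inj hr).1 ha.1

theorem sublist_append_left_of_not_mem {l u v : List ℕ} {a : ℕ}
    (h : (l ++ [a]).Sublist (u ++ v)) (ha : a ∉ v) : (l ++ [a]).Sublist u := by
  have h := List.reverse_sublist.2 h
  simp only [List.reverse_append, List.reverse_cons, List.reverse_nil, List.nil_append,
    List.singleton_append] at h
  have := List.reverse_sublist.2 (sublist_append_right_of_not_mem h (by simpa using ha))
  simpa using this

/-- The alternatives record where the cut falls; all cuts leaving at least two letters on the right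
are merged, because only `[c, d]` is needed there. -/
theorem sublist_quad {a b c d : ℕ} {u v : List ℕ} (h : [a, b, c, d].Sublist (u ++ v)) :
    [a, b, c, d].Sublist u ∨ ([a, b, c].Sublist u ∧ d ∈ v) ∨ [c, d].Sublist v := by
  obtain ⟨l₁, l₂, h, h1, h2⟩ := List.sublist_append_iff.1 h
  match l₁, h with
  | [], h =>
    simp only [List.nil_append] at h
    subst h
    exact Or.inr (Or.inr (List.Sublist.trans (by simp) h2))
  | [x], h =>
    simp at h; obtain ⟨rfl, rfl⟩ := h
    exact Or.inr (Or.inr (List.Sublist.trans (by simp) h2))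
  | [x, y], h =>
    simp at h; obtain ⟨rfl, rfl, rfl⟩ := h
    exact Or.inr (Or.inr h2)
  | [x, y, z], h =>
    simp at h; obtain ⟨rfl, rfl, rfl, rfl⟩ := h
    exact Or.inr (Or.inl ⟨h1, by simpa using h2⟩)
  | x :: y :: z :: t :: r, h =>
    simp at h; obtain ⟨rfl, rfl, rfl, rfl, rfl, rfl⟩ := h
    exact Or.inl h1

theorem sublist_triple {a b c : ℕ} {u v : List ℕ} (h : [a, b, c].Sublist (u ++ v)) :
    [a, b, c].Sublist u ∨ c ∈ v := by
  by_cases hc : c ∈ v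
  · exact Or.inr hc
  · exact Or.inl (sublist_append_left_of_not_mem (l := [a, b]) h hc)

theorem Hit.mono {u w : List ℕ} {a : ℕ} (h : Hit u a) (hs : u.Sublist w) : Hit w a := by
  obtain ⟨b, hb, h⟩ := h
  exact ⟨b, hb, h.trans hs⟩

theorem Hit.lt_bound {w : List ℕ} {a : ℕ} (h : Hit w a) : a < bound w := by
  obtain ⟨b, hb, h⟩ := h
  exact AscentSeq.lt_bound (h.subset (by simp))

theorem Av.mono {u w : List ℕ} (h : Av w) (hs : u.Sublist w) : Av u :=
  fun a b c hab hac hsub => h a b c hab hac (hsub.trans hs)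

theorem Nc.mono {u w : List ℕ} (h : Nc w) (hs : u.Sublist w) : Nc u :=
  fun a ha => h a (ha.mono hs)

theorem Nc.av {w : List ℕ} (h : Nc w) : Av w :=
  fun a b _ hab _ hsub => h a ⟨b, hab, List.Sublist.trans (by simp) hsub⟩

theorem map_add_injective (s : ℕ) : Function.Injective (List.map (· + s)) :=
  List.map_injective_iff.2 (add_left_injective s)

theorem sublist_map_add {w l : List ℕ} {s : ℕ} :
    l.Sublist (w.map (· + s)) ↔ ∃ l' : List ℕ, l'.Sublist w ∧ l = l'.map (· + s) := List.sublist_map_iff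

theorem hit_map_add {w : List ℕ} {a s : ℕ} :
    Hit (w.map (· + s)) a ↔ ∃ a', a = a' + s ∧ Hit w a' := by
  constructor
  · rintro ⟨b, hb, h⟩
    obtain ⟨l, hl, h⟩ := sublist_map_add.1 h
    rcases l with _ | ⟨x, _ | ⟨y, _ | ⟨z, _ | ⟨t, l⟩⟩⟩⟩ <;> simp at h
    · obtain ⟨h1, h2, h3⟩ := h
      obtain rfl : z = x := by omega
      exact ⟨z, h1, y, by omega, hl⟩
  · rintro ⟨a, rfl, b, hb, h⟩
    exact ⟨b + s, by omega, h.map (· + s)⟩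

theorem av_map_add {w : List ℕ} {s : ℕ} : Av (w.map (· + s)) ↔ Av w := by
  constructor
  · intro h a b c hab hac hsub
    exact h (a + s) (b + s) (c + s) (by omega) (by omega) (hsub.map (· + s))
  · intro h a b c hab hac hsub
    obtain ⟨l, hl, h'⟩ := sublist_map_add.1 hsub
    rcases l with _ | ⟨x, _ | ⟨y, _ | ⟨z, _ | ⟨t, _ | ⟨r, l⟩⟩⟩⟩⟩ <;> simp at h'
    · obtain ⟨h1, h2, h3, h4⟩ := h'
      obtain rfl : z = x := by omega
      exact h z y t (by omega) (by omega) hl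

theorem nc_map_add {w : List ℕ} {s : ℕ} : Nc (w.map (· + s)) ↔ Nc w := by
  simp only [Nc, hit_map_add]
  constructor
  · intro h a ha
    exact h (a + s) ⟨a, rfl, ha⟩
  · rintro h _ ⟨a, rfl, ha⟩
    exact h a ha

/-! ### The statistic -/

theorem stat_eq {w : List ℕ} {s : ℕ} (h1 : s ≤ bound w - 1) (h2 : ∀ a < s, ¬ Hit w a)
    (h3 : s = bound w - 1 ∨ Hit w s) : stat w = s := by
  classical
  unfold stat
  rw [Nat.findGreatest_eq_iff]
  refine ⟨h1, fun _ => h2, fun n hn hn' h => ?_⟩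
  rcases h3 with h3 | h3
  · omega
  · exact h s hn h3

theorem stat_le (w : List ℕ) : stat w ≤ bound w - 1 := by
  classical
  exact Nat.findGreatest_le _

theorem not_hit_of_lt_stat {w : List ℕ} {a : ℕ} (h : a < stat w) : ¬ Hit w a := by
  classical
  have := Nat.findGreatest_spec (P := fun c => ∀ a < c, ¬ Hit w a) (m := 0) (n := bound w - 1)
    (Nat.zero_le _) (by simp)
  exact this a h

theorem le_stat {w : List ℕ} {c : ℕ} (h : c ≤ bound w - 1) (h' : ∀ a < c, ¬ Hit w a) :
    c ≤ stat w := by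
  classical
  exact Nat.le_findGreatest h h'

/-- By maximality: if `stat w` were neither the largest letter nor hit, its successor would also
qualify. -/
theorem stat_eq_or_hit (w : List ℕ) : stat w = bound w - 1 ∨ Hit w (stat w) := by
  by_contra! h
  have : stat w + 1 ≤ stat w := by
    refine le_stat (by have := stat_le w; omega) fun a ha => ?_
    rcases Nat.lt_succ_iff_lt_or_eq.1 ha with ha | rfl
    · exact not_hit_of_lt_stat ha
    · exact h.2
  omega

theorem Nc.stat_eq {w : List ℕ} (h : Nc w) : stat w = bound w - 1 :=
  AscentSeq.stat_eq le_rfl (fun a _ => h a) (Or.inl rfl)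

/-! ### Decomposition at the last zero -/

/-- Weakly decreasing words with letters in `[1, q]`. -/
def Tail (q : ℕ) (D : List ℕ) : Prop := D.Pairwise (· ≥ ·) ∧ ∀ d ∈ D, 1 ≤ d ∧ d ≤ q

/-- The word `L0A'D`, where `A'` is the translate of `A` to letters not used in `L0`. -/
def build (L A D : List ℕ) : List ℕ := L ++ 0 :: (A.map (· + max 1 (bound L)) ++ D)

theorem tail_nil (q : ℕ) : Tail q [] := by simp [Tail]

theorem tail_zero {D : List ℕ} : Tail 0 D ↔ D = [] := by
  constructor
  · rintro ⟨_, h⟩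
    refine List.eq_nil_iff_forall_not_mem.2 fun d hd => ?_
    have := h d hd
    omega
  · rintro rfl
    exact tail_nil 0

theorem Tail.mono {q r : ℕ} {D : List ℕ} (h : Tail q D) (hqr : q ≤ r) : Tail r D :=
  ⟨h.1, fun d hd => ⟨(h.2 d hd).1, (h.2 d hd).2.trans hqr⟩⟩

theorem append_cons_inj_of_not_mem {L L' R R' : List ℕ} {a : ℕ} (h : L ++ a :: R = L' ++ a :: R')
    (hR : a ∉ R) (hR' : a ∉ R') : L = L' ∧ R = R' := by
  rcases List.append_eq_append_iff.1 h with ⟨B, rfl, hB⟩ | ⟨B, rfl, hB⟩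
  · cases B with
    | nil => simpa using hB
    | cons b B => simp at hB; simp [hB.2] at hR
  · cases B with
    | nil => simpa [eq_comm] using hB
    | cons b B => simp at hB; simp [hB.2] at hR'

/-- The separating 0 is the last 0 of the word, which determines `L`; the later letters that are at
least `max 1 (bound L)` are then exactly those of the translate of `A`. -/
theorem build_inj {L A D L' A' D' : List ℕ} (hD : Tail (bound L - 1) D)
    (hD' : Tail (bound L' - 1) D') (h : build L A D = build L' A' D') :
    L = L' ∧ A = A' ∧ D = D' := by
  have not_mem : ∀ {L A D : List ℕ}, Tail (bound L - 1) D → 0 ∉ A.map (· + max 1 (bound L)) ++ D := by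
    intro L A D hD
    simp only [List.mem_append, List.mem_map, not_or]
    refine ⟨?_, fun h0 => by have := hD.2 0 h0; omega⟩
    rintro ⟨a, _, ha⟩
    omega
  obtain ⟨rfl, h⟩ := append_cons_inj_of_not_mem h (not_mem hD) (not_mem hD')
  have key : ∀ {A D : List ℕ}, Tail (bound L - 1) D →
      (A.map (· + max 1 (bound L)) ++ D).filter (max 1 (bound L) ≤ ·)
        = A.map (· + max 1 (bound L)) := by
    intro A D hD
    rw [List.filter_append, List.filter_eq_self.2 (by simp; omega), List.filter_eq_nil_iff.2,
      List.append_nil]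
    intro d hd
    have := hD.2 d hd
    simp only [decide_eq_true_eq]
    omega
  have hA := congrArg (List.filter (max 1 (bound L) ≤ ·)) h
  rw [key hD, key hD'] at hA
  have := map_add_injective _ hA
  subst this
  exact ⟨rfl, rfl, List.append_cancel_left h⟩

theorem build_length (L A D : List ℕ) :
    (build L A D).length = L.length + A.length + D.length + 1 := by
  simp [build]
  omega

theorem bound_build {L A D : List ℕ} (hL : L ≠ []) (hD : Tail (bound L - 1) D) :
    bound (build L A D) = bound L + bound A := by
  have h1 := bound_pos hL
  have h2 : bound D ≤ bound L := bound_le_iff.2 fun d hd => by have := hD.2 d hd; omega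
  rcases eq_or_ne A [] with rfl | hA
  · simp [build]; omega
  · simp [build, bound_map_add hA]; omega

theorem bound_build_nil (A : List ℕ) : bound (build [] A []) = bound A + 1 := by
  rcases eq_or_ne A [] with rfl | hA
  · simp [build]
  · simp [build, bound_map_add hA]

theorem build_ne_nil (L A D : List ℕ) : build L A D ≠ [] := by simp [build]

theorem grow_build {L A D : List ℕ} (hL : Grow 0 L) (hA : Grow 0 A) (hD : Tail (bound L - 1) D) :
    Grow 0 (build L A D) := by
  refine grow_append.2 ⟨hL, by simp, grow_append.2 ⟨?_, grow_of_forall_le fun d hd => ?_⟩⟩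
  -- The separating 0 makes the bound at least 1 even when `L` is empty, which is why the shift is
  -- `max 1 (bound L)`.
  · have : max (max 0 (bound L)) (0 + 1) = 0 + max 1 (bound L) := by omega
    rw [this]
    exact grow_map_add.2 hA
  · have := hD.2 d hd
    omega

/-- A 101 in `L` cannot be extended by `D`, since its repeated letter is at least `stat L`; and `D`
contains no increasing pair to finish a pattern. -/
theorem av_build_of_tail_stat {L D : List ℕ} (hL : Av L) (hD : Tail (stat L) D) :
    Av (build L [] D) := by
  intro a b c hab hac h
  simp only [build, List.map_nil, List.nil_append] at h
  rcases sublist_quad h with h | ⟨h, hc⟩ | h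
  · exact hL a b c hab hac h
  · rcases List.mem_cons.1 hc with rfl | hc
    · omega
    · have := (hD.2 c hc).2
      exact not_hit_of_lt_stat (w := L) (a := a) (by omega) ⟨b, hab, h⟩
  · have h := sublist_append_right_of_not_mem (u := [0]) h (by simp; omega)
    have := List.pairwise_pair.1 (hD.1.sublist h)
    omega

theorem build_sublist_right {L A D l : List ℕ} {a : ℕ} (ha : max 1 (bound L) ≤ a)
    (h : (a :: l).Sublist (build L A D)) : (a :: l).Sublist (A.map (· + max 1 (bound L)) ++ D) := by
  have h := sublist_append_right_of_not_mem h fun hL => by have := lt_bound hL; omega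
  exact sublist_append_right_of_not_mem (u := [0]) h (by simp; omega)

/-- As `L` has no 101, the last two letters of a 1012 lie after the separator. The repeated letter
cannot come from `D`, which is weakly decreasing and lies below the translate of `A`, so the whole
pattern falls inside that translate. -/
theorem av_build_of_nc {L A D : List ℕ} (hL : Nc L) (hA : Av A) (hD : Tail (bound L - 1) D) :
    Av (build L A D) := by
  intro a b c hab hac h
  rcases sublist_quad h with h' | ⟨h', hc⟩ | h'
  · exact hL.av a b c hab hac h'
  · exact hL a ⟨b, hab, h'⟩
  · have h' := sublist_append_right_of_not_mem (u := [0]) h' (by simp; omega)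
    have hcD : max 1 (bound L) ≤ a ∧ c ∉ D := by
      have hmem : a ∈ A.map (· + max 1 (bound L)) ∨ a ∈ D :=
        List.mem_append.1 (h'.subset (by simp))
      by_cases haA : a ∈ A.map (· + max 1 (bound L))
      · obtain ⟨x, _, rfl⟩ := List.mem_map.1 haA
        refine ⟨by simp, fun hc => ?_⟩
        have := hD.2 c hc
        omega
      · have := List.pairwise_pair.1
          (hD.1.sublist (sublist_append_right_of_not_mem h' haA))
        omega
    have h := build_sublist_right hcD.1 h
    have h := sublist_append_left_of_not_mem (l := [a, b, a]) h hcD.2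
    exact av_map_add.2 hA a b c hab hac h

theorem hit_build_iff {L A : List ℕ} (hL : Nc L) {a : ℕ} :
    Hit (build L A []) a ↔ ∃ a', a = a' + max 1 (bound L) ∧ Hit A a' := by
  rw [← hit_map_add]
  constructor
  · rintro ⟨b, hb, h⟩
    refine ⟨b, hb, ?_⟩
    have ha : a ∈ A.map (· + max 1 (bound L)) := by
      rcases sublist_triple h with h | h
      · exact absurd ⟨b, hb, h⟩ (hL a)
      · simp only [List.append_nil, List.mem_cons] at h
        exact h.resolve_left (by omega)
    obtain ⟨x, _, hx⟩ := List.mem_map.1 ha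
    simpa using build_sublist_right (by omega) h
  · rintro ⟨b, hb, h⟩
    refine ⟨b, hb, h.trans ?_⟩
    simp only [build, List.append_nil]
    exact (List.sublist_cons_self _ _).trans (List.sublist_append_right _ _)

theorem nc_build {L A : List ℕ} (hL : Nc L) (hA : Nc A) : Nc (build L A []) := by
  intro a ha
  obtain ⟨a', _, h⟩ := (hit_build_iff hL).1 ha
  exact hA a' h

theorem stat_build_of_nc {L A : List ℕ} (hL : Nc L) (hA : A ≠ []) :
    stat (build L A []) = max 1 (bound L) + stat A := by
  have hb : bound (build L A []) = max 1 (bound L) + bound A := by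
    rcases eq_or_ne L [] with rfl | hL'
    · rw [bound_build_nil]
      simp
      omega
    · rw [bound_build hL' (tail_nil _), max_eq_right (bound_pos hL')]
  have hA := bound_pos hA
  refine stat_eq ?_ (fun a ha h => ?_) ?_
  · have := stat_le A
    omega
  · obtain ⟨a', rfl, h'⟩ := (hit_build_iff hL).1 h
    exact not_hit_of_lt_stat (w := A) (a := a') (by omega) h'
  · rcases stat_eq_or_hit A with h | h
    · left
      omega
    · exact Or.inr ((hit_build_iff hL).2 ⟨_, add_comm _ _, h⟩)

theorem stat_build_nil_nil {L : List ℕ} (hL : L ≠ []) : stat (build L [] []) = stat L := by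
  have hit : ∀ a, Hit (build L [] []) a ↔ Hit L a := fun a => by
    constructor
    · rintro ⟨b, hb, h⟩
      exact ⟨b, hb, sublist_append_left_of_not_mem (l := [a, b]) h (by simp; omega)⟩
    · exact fun h => h.mono (by simp [build])
  have hb : bound (build L [] []) = bound L := by simp [bound_build hL (tail_nil _)]
  refine stat_eq (hb ▸ stat_le L) (fun a ha h => ?_) ?_
  · exact not_hit_of_lt_stat ha ((hit a).1 h)
  · rw [hb, hit]
    exact stat_eq_or_hit L

/-- A smaller hit letter `a` would have its pattern `a b a` completed before the final `d`, and `a b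
a d` is a 1012. -/
theorem stat_of_hit_last {w : List ℕ} {d : ℕ} (h : Av (w ++ [d])) (hd : Hit (w ++ [d]) d) :
    stat (w ++ [d]) = d := by
  refine stat_eq ?_ ?_ (Or.inr hd)
  · have := hd.lt_bound
    omega
  · rintro a ha ⟨b, hb, hs⟩
    have := sublist_append_left_of_not_mem (l := [a, b]) hs (by simp; omega)
    exact h a b d hb ha (List.Sublist.append this (List.Sublist.refl [d]))

theorem stat_build_of_tail {L A D : List ℕ} (hL : Grow 0 L) (hD : Tail (bound L - 1) D)
    (hne : D ≠ []) (h : Av (build L A D)) : stat (build L A D) = D.getLast hne := by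
  have hd := hD.2 _ (List.getLast_mem hne)
  set d := D.getLast hne with hdd
  have hw : build L A D = (L ++ 0 :: (A.map (· + max 1 (bound L)) ++ D.dropLast)) ++ [d] := by
    conv_lhs => rw [← List.dropLast_append_getLast hne]
    simp [build, hdd]
  rw [hw] at h ⊢
  refine stat_of_hit_last h ⟨0, by omega, ?_⟩
  -- By restricted growth `d` already occurs in `L`, so the separating 0 makes the final `d` close a
  -- 101.
  have h1 : [d].Sublist L := List.singleton_sublist.2 (mem_of_grow hL (by omega) (by omega))
  have h2 : [0].Sublist (0 :: (A.map (· + max 1 (bound L)) ++ D.dropLast)) := by simp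
  exact (h1.append h2).append (List.Sublist.refl [d])

theorem exists_last_zero {w : List ℕ} (hw : w ≠ []) (hg : Grow 0 w) :
    ∃ L R, w = L ++ 0 :: R ∧ 0 ∉ R := by
  have h0 : (0 : ℕ) ∈ w := mem_of_grow hg le_rfl (bound_pos hw)
  obtain ⟨R, L, h, hR⟩ := List.eq_append_cons_of_mem (List.mem_reverse.2 h0)
  refine ⟨L.reverse, R.reverse, ?_, by simpa using hR⟩
  simpa using congrArg List.reverse h

/-- The hypothesis says that after a letter below `s` nothing larger follows, so `R` is weakly
decreasing from the first such letter on. -/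
theorem exists_split {R : List ℕ} {s : ℕ}
    (h : ∀ d e, d < s → d < e → ¬ [d, e].Sublist R) :
    ∃ A D : List ℕ, R = A.map (· + s) ++ D ∧ D.Pairwise (· ≥ ·) ∧ ∀ d ∈ D, d < s := by
  induction R with
  | nil => exact ⟨[], [], by simp⟩
  | cons a R ih =>
    rcases lt_or_ge a s with ha | ha
    · have hle : ∀ e ∈ R, e ≤ a := fun e he => not_lt.1 fun hae =>
        h a e ha hae (List.Sublist.cons_cons a (List.singleton_sublist.2 he))
      have hlt : ∀ d ∈ a :: R, d < s := by
        simp only [List.mem_cons, forall_eq_or_imp]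
        exact ⟨ha, fun e he => (hle e he).trans_lt ha⟩
      refine ⟨[], a :: R, by simp, List.pairwise_iff_forall_sublist.2 ?_, hlt⟩
      intro d e hde
      exact not_lt.1 fun hlt' => h d e (hlt d (hde.subset (by simp))) hlt' hde
    · obtain ⟨A, D, rfl, h2, h3⟩ := ih fun d e hd hde hs => h d e hd hde (hs.cons a)
      exact ⟨(a - s) :: A, D, by simp [Nat.sub_add_cancel ha], h2, h3⟩

theorem exists_build {w : List ℕ} (hw : w ≠ []) (hg : Grow 0 w) (hav : Av w) :
    ∃ L A D, w = build L A D ∧ Grow 0 L ∧ Grow 0 A ∧ Av L ∧ Av A ∧ Tail (bound L - 1) D ∧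
      (A ≠ [] → Nc L) ∧ (A = [] → Tail (stat L) D) := by
  obtain ⟨L, R, rfl, h0⟩ := exists_last_zero hw hg
  have hgL := (grow_append.1 hg).1
  have hmem : ∀ d, d ≠ 0 → d < max 1 (bound L) → d ∈ L := fun d hd0 hd =>
    mem_of_grow hgL (Nat.zero_le _) (by omega)
  obtain ⟨A, D, rfl, hD, hlt⟩ := exists_split (R := R) (s := max 1 (bound L)) (by
    intro d e hd hde hs
    have hd0 : d ≠ 0 := fun h => h0 (h ▸ hs.subset (by simp))
    -- The first `d` is taken from `L`, the 0 is the separator.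
    exact hav d 0 e (by omega) hde
      ((List.singleton_sublist.2 (hmem d hd0 hd)).append (List.Sublist.cons_cons 0 hs)))
  have hpos : ∀ d ∈ D, d ≠ 0 := fun d hd h => h0 (by simp [← h, hd])
  have hT : Tail (bound L - 1) D :=
    ⟨hD, fun d hd => by have := hpos d hd; have := hlt d hd; omega⟩
  refine ⟨L, A, D, rfl, hgL, ?_, hav.mono (List.sublist_append_left _ _), ?_, hT, ?_, ?_⟩
  · have := (grow_append.1 (grow_append.1 hg).2.2).1
    have hm : max (max 0 (bound L)) (0 + 1) = 0 + max 1 (bound L) := by omega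
    rw [hm] at this
    exact grow_map_add.1 this
  · refine (av_map_add (s := max 1 (bound L))).1 (hav.mono ?_)
    exact ((List.sublist_append_left _ _).cons 0).trans (List.sublist_append_right _ _)
  · rintro hA a ⟨b, hb, h⟩
    obtain ⟨c, hc⟩ := List.exists_mem_of_ne_nil A hA
    have := lt_bound (h.subset (show a ∈ [a, b, a] by simp))
    refine hav a b (c + max 1 (bound L)) hb (by omega) (h.append (List.singleton_sublist.2 ?_))
    simp [hc]
  · rintro rfl
    refine ⟨hD, fun d hd => ⟨(hT.2 d hd).1, le_stat (hT.2 d hd).2 ?_⟩⟩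
    rintro a ha ⟨b, hb, h⟩
    refine hav a b d hb ha (h.append (List.singleton_sublist.2 ?_))
    simp [hd]

theorem nc_of_nc_build {L A D : List ℕ} (hL : Grow 0 L) (hD : Tail (bound L - 1) D)
    (h : Nc (build L A D)) : Nc L ∧ Nc A ∧ D = [] := by
  refine ⟨h.mono (List.sublist_append_left _ _), (nc_map_add (s := max 1 (bound L))).1 (h.mono ?_),
    ?_⟩
  · exact ((List.sublist_append_left _ _).cons 0).trans (List.sublist_append_right _ _)
  · refine List.eq_nil_iff_forall_not_mem.2 fun d hd => h d ⟨0, (hD.2 d hd).1, ?_⟩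
    have := hD.2 d hd
    have h1 : [d].Sublist L := List.singleton_sublist.2 (mem_of_grow hL (by omega) (by omega))
    refine h1.append (List.Sublist.cons_cons 0 ?_)
    simp [hd]

/-! ### Ascent sequences versus restricted growth words -/

theorem contains_iff_not_av {x : List ℕ} : Contains x [1, 0, 1, 2] ↔ ¬ Av x := by
  constructor
  · rintro ⟨f, hf, h⟩ hav
    refine hav (x.get (f 0)) (x.get (f 1)) (x.get (f 3)) ((h 1 0).1.2 (by decide))
      ((h 0 3).1.2 (by decide)) ?_
    have h02 : x.get (f 0) = x.get (f 2) := by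
      have h1 := (h 0 2).1
      have h2 := (h 2 0).1
      simp at h1 h2 ⊢
      omega
    rw [List.sublist_iff_exists_fin_orderEmbedding_get_eq]
    refine ⟨OrderEmbedding.ofStrictMono f hf, fun i => ?_⟩
    change Fin 4 at i
    fin_cases i
    · rfl
    · rfl
    · exact h02
    · rfl
  · intro h
    unfold Av at h
    push Not at h
    obtain ⟨a, b, c, hab, hac, h⟩ := h
    obtain ⟨f, hf⟩ := List.sublist_iff_exists_fin_orderEmbedding_get_eq.1 h
    refine ⟨f, f.strictMono, fun i j => ?_⟩
    have hi := hf i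
    have hj := hf j
    rw [← hi, ← hj]
    change Fin 4 at i j
    fin_cases i <;> fin_cases j <;> simp <;> omega

theorem asc_append_pair (u : List ℕ) (b c : ℕ) :
    asc (u ++ [b, c]) = asc (u ++ [b]) + if b < c then 1 else 0 := by
  induction u with
  | nil => simp [asc]
  | cons a u ih =>
    cases u with
    | nil => simp [asc]
    | cons a' u =>
      simp only [List.cons_append, asc] at ih ⊢
      rw [ih, add_assoc]

theorem isAscentSeq_append_singleton {u : List ℕ} {c : ℕ} :
    IsAscentSeq (u ++ [c]) ↔
      IsAscentSeq u ∧ (u = [] → c = 0) ∧ (u ≠ [] → c ≤ asc u + 1) := by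
  rcases eq_or_ne u [] with rfl | hu
  · simp [IsAscentSeq]
  · have hpos := List.length_pos_of_ne_nil hu
    simp only [IsAscentSeq, hu, ne_eq, not_false_eq_true, forall_const, false_implies, true_and]
    constructor
    · rintro ⟨h0, h⟩
      refine ⟨⟨fun _ => ?_, fun i hi hi0 => ?_⟩, ?_⟩
      · simpa [List.getElem_append_left hpos] using h0 (by simp)
      · have := h i (by simp; omega) hi0
        rwa [List.getElem_append_left hi, List.take_append_of_le_length hi.le] at this
      · simpa using h u.length (by simp) hpos
    · rintro ⟨⟨h0, h⟩, hc⟩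
      refine ⟨fun _ => ?_, fun i hi hi0 => ?_⟩
      · simpa [List.getElem_append_left hpos] using h0 hpos
      · rcases lt_or_ge i u.length with hlt | hge
        · rw [List.getElem_append_left hlt, List.take_append_of_le_length hlt.le]
          exact h i hlt hi0
        · obtain rfl : i = u.length := by simp at hi; omega
          simpa using hc

theorem bound_le_asc {u : List ℕ} (hg : Grow 0 u) : bound u ≤ asc u + 1 := by
  induction u using List.reverseRecOn with
  | nil => simp
  | append_singleton u c ih =>
    obtain ⟨hg, hc, -⟩ := grow_append.1 hg
    have ih := ih hg
    rcases List.eq_nil_or_concat' u with rfl | ⟨v, b, rfl⟩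
    · simp at hc
      simp [hc]
    · rw [List.append_assoc, List.singleton_append, asc_append_pair]
      simp only [bound_append, bound_cons, bound_nil] at hc ih ⊢
      split_ifs <;> omega

/-- Each ascent `b < c` must reach a new maximum: otherwise `c` occurred earlier, and `c b c` is a
101. -/
theorem asc_lt_bound {u : List ℕ} (hg : Grow 0 u) (hn : Nc u) (hu : u ≠ []) :
    asc u < bound u := by
  induction u using List.reverseRecOn with
  | nil => exact absurd rfl hu
  | append_singleton u c ih =>
    have hg' := (grow_append.1 hg).1
    rcases List.eq_nil_or_concat' u with rfl | ⟨v, b, rfl⟩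
    · simp [asc]
    · have ih := ih hg' (hn.mono (List.sublist_append_left _ _)) (by simp)
      rw [bound_append, List.append_assoc, List.singleton_append, asc_append_pair]
      simp only [bound_cons, bound_nil]
      split_ifs with hbc
      · rcases lt_or_ge c (bound (v ++ [b])) with h | h
        · have hc : c ∈ v := by
            have := mem_of_grow hg' (Nat.zero_le c) h
            simp only [List.mem_append, List.mem_singleton] at this
            exact this.resolve_right (by omega)
          refine absurd ⟨b, hbc, ?_⟩ (hn c)
          rw [List.append_assoc]
          exact (List.singleton_sublist.2 hc).append (List.Sublist.refl [b, c])
        · omega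
      · omega

theorem isAscentSeq_iff_grow {w : List ℕ} (hav : Av w) : IsAscentSeq w ↔ Grow 0 w := by
  induction w using List.reverseRecOn with
  | nil => simp [IsAscentSeq, Grow]
  | append_singleton u c ih =>
    rw [isAscentSeq_append_singleton, grow_append, ih (hav.mono (List.sublist_append_left _ _))]
    refine and_congr_right fun hg => ?_
    simp only [Grow, and_true, Nat.zero_max]
    rcases eq_or_ne u [] with rfl | hu
    · simp
    · simp only [hu, ne_eq, not_false_eq_true, forall_const, false_implies, true_and]
      refine ⟨fun h => ?_, fun h => h.trans (bound_le_asc hg)⟩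
      -- Without a 101, ascents are too few to allow a jump; with a 101, any letter above the
      -- maximum completes a 1012.
      by_cases hn : Nc u
      · exact h.trans (asc_lt_bound hg hn hu)
      · simp only [Nc, not_forall, not_not] at hn
        obtain ⟨a, b, hb, hs⟩ := hn
        by_contra! hlt
        have := lt_bound (hs.subset (show a ∈ [a, b, a] by simp))
        exact hav a b c hb (by omega) (hs.append (List.Sublist.refl [c]))

theorem mem_avoiders_iff {n : ℕ} {w : List ℕ} :
    w ∈ avoiders [1, 0, 1, 2] n ↔ w.length = n ∧ Grow 0 w ∧ Av w := by
  simp only [avoiders, Set.mem_ofPred_eq, contains_iff_not_av, not_not]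
  refine and_congr_right fun _ => ?_
  rw [and_comm, and_comm (a := Grow 0 w)]
  exact and_congr_right isAscentSeq_iff_grow

/-! ### Finiteness and summability of families of words -/

theorem finite_grow (n : ℕ) : {w : List ℕ | w.length < n ∧ Grow 0 w}.Finite := by
  refine ((List.finite_length_lt (Fin n) n).image (List.map Fin.val)).subset ?_
  rintro w ⟨hl, hg⟩
  have hb := bound_le_iff.1 (bound_le_length hg)
  refine ⟨w.attach.map fun a => ⟨a.1, by have := hb _ a.2; omega⟩, by simpa using hl, ?_⟩
  simp

theorem finite_tail (n q : ℕ) : {w : List ℕ | w.length < n ∧ Tail q w}.Finite := by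
  refine ((List.finite_length_lt (Fin (q + 1)) n).image (List.map Fin.val)).subset ?_
  rintro w ⟨hl, hg⟩
  refine ⟨w.attach.map fun a => ⟨a.1, by have := hg.2 _ a.2; omega⟩, by simpa using hl, ?_⟩
  simp

open PowerSeries
open scoped PowerSeries.WithPiTopology

/-- Only finitely many terms contribute to any given coefficient, so convergence is coefficientwise
and no size condition on `g` is needed. -/
theorem summable_X_pow_mul {ι : Type*} (len : ι → ℕ) (hfin : ∀ n, {i | len i < n}.Finite)
    (g : ι → ℚ⟦X⟧) : Summable fun i => (X : ℚ⟦X⟧) ^ len i * g i := by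
  rw [PowerSeries.WithPiTopology.summable_iff_summable_coeff]
  intro d
  refine summable_of_hasFiniteSupport ((hfin (d + 1)).subset fun i hi => ?_)
  simp only [Function.mem_support, coeff_X_pow_mul', ne_eq, ite_eq_right_iff, not_forall] at hi
  exact Nat.lt_succ_of_le hi.1

/-- Nonempty `1012`-avoiding restricted growth words. -/
abbrev AvWord := {w : List ℕ // w ≠ [] ∧ Grow 0 w ∧ Av w}

/-- Nonempty `101`-avoiding restricted growth words. -/
abbrev NcWord := {w : List ℕ // w ≠ [] ∧ Grow 0 w ∧ Nc w}

/-- Weakly decreasing words with letters in `[1, q]`. -/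
abbrev TailWord (q : ℕ) := {w : List ℕ // Tail q w}

theorem finite_avWord (n : ℕ) : {w : AvWord | w.1.length < n}.Finite :=
  ((finite_grow n).subset (by rintro _ ⟨w, hw, rfl⟩; exact ⟨hw, w.2.2.1⟩)).of_finite_image
    Subtype.val_injective.injOn

theorem finite_ncWord (n : ℕ) : {w : NcWord | w.1.length < n}.Finite :=
  ((finite_grow n).subset (by rintro _ ⟨w, hw, rfl⟩; exact ⟨hw, w.2.2.1⟩)).of_finite_image
    Subtype.val_injective.injOn

theorem finite_tailWord (n q : ℕ) : {w : TailWord q | w.1.length < n}.Finite :=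
  ((finite_tail n q).subset (by rintro _ ⟨w, hw, rfl⟩; exact ⟨hw, w.2⟩)).of_finite_image
    Subtype.val_injective.injOn

theorem finite_length_add_lt {ι κ : Type*} {f : ι → ℕ} {g : κ → ℕ}
    (hf : ∀ n, {i | f i < n}.Finite) (hg : ∀ n, {j | g j < n}.Finite) (n : ℕ) :
    {x : ι × κ | f x.1 + g x.2 < n}.Finite :=
  ((hf n).prod (hg n)).subset fun x hx => by
    simp only [Set.mem_ofPred_eq, Set.mem_prod] at hx ⊢
    omega

theorem hasSum_mul_of_finite {ι κ : Type*} {f : ι → ℕ} {g : κ → ℕ}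
    (hf : ∀ n, {i | f i < n}.Finite) (hg : ∀ n, {j | g j < n}.Finite) {a : ι → ℚ⟦X⟧}
    {b : κ → ℚ⟦X⟧} {s t : ℚ⟦X⟧} (ha : HasSum (fun i => X ^ f i * a i) s)
    (hb : HasSum (fun j => X ^ g j * b j) t) :
    HasSum (fun x : ι × κ => X ^ f x.1 * a x.1 * (X ^ g x.2 * b x.2)) (s * t) := by
  have h := summable_X_pow_mul (fun x : ι × κ => f x.1 + g x.2) (finite_length_add_lt hf hg)
    fun x => a x.1 * b x.2
  have heq : (fun x : ι × κ => (X : ℚ⟦X⟧) ^ (f x.1 + g x.2) * (a x.1 * b x.2)) =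
      fun x : ι × κ => X ^ f x.1 * a x.1 * (X ^ g x.2 * b x.2) := by
    funext x
    ring
  rw [heq] at h
  exact HasSum.mul (f := fun i => X ^ f i * a i) (g := fun j => X ^ g j * b j) ha hb h

/-! ### Weakly decreasing words -/

/-- The weight `X ^ |D| * v ^ d`, where `d` is the last letter of `D`; the factor `v ^ d` is
replaced by `e` when `D` is empty. -/
noncomputable def tailWeight (v e : ℚ⟦X⟧) (D : List ℕ) : ℚ⟦X⟧ :=
  X ^ D.length * D.getLast?.elim e (v ^ ·)

/-- The sum of `X ^ |D| * v ^ d` over the nonempty weakly decreasing words `D` with letters in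
`[1, q]` and last letter `d`. -/
noncomputable def tailSum (v : ℚ⟦X⟧) : ℕ → ℚ⟦X⟧
  | 0 => 0
  | q + 1 => tailSum v q + (1 - X)⁻¹ * X * (v ^ (q + 1) + tailSum v q)

theorem inv_mul_one_sub_X : (1 - X : ℚ⟦X⟧)⁻¹ * (1 - X) = 1 := PowerSeries.inv_mul_cancel _ (by simp)

/-- A geometric sum with its denominator cleared. The difference of `q`-th powers is what turns sums
over `L` into differences of generating functions at `v` and at `(1 - X)⁻¹`. -/
theorem tailSum_closed (v : ℚ⟦X⟧) (q : ℕ) :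
    (v - (1 - X)⁻¹) * tailSum v q = ((1 - X)⁻¹ - 1) * v * (v ^ q - (1 - X)⁻¹ ^ q) := by
  have hy := inv_mul_one_sub_X
  set y : ℚ⟦X⟧ := (1 - X)⁻¹
  have hyX : y * X = y - 1 := by linear_combination -hy
  induction q with
  | zero => simp [tailSum]
  | succ q ih =>
    rw [tailSum, hyX]
    linear_combination y * ih

theorem tail_cons_iff {q : ℕ} {D : List ℕ} : Tail (q + 1) ((q + 1) :: D) ↔ Tail (q + 1) D := by
  constructor
  · rintro ⟨h1, h2⟩
    exact ⟨(List.pairwise_cons.1 h1).2, fun d hd => h2 d (List.mem_cons_of_mem _ hd)⟩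
  · rintro ⟨h1, h2⟩
    exact ⟨List.pairwise_cons.2 ⟨fun d hd => (h2 d hd).2, h1⟩, by simpa using h2⟩

theorem hasSum_tailWeight (v e : ℚ⟦X⟧) (q : ℕ) :
    HasSum (fun D : TailWord q => tailWeight v e D.1) (e + tailSum v q) := by
  induction q generalizing e with
  | zero =>
    have : Unique (TailWord 0) :=
      { default := ⟨[], tail_nil 0⟩, uniq := fun D => Subtype.ext (tail_zero.1 D.2) }
    convert hasSum_unique (fun D : TailWord 0 => tailWeight v e D.1) using 1
    rw [show (default : TailWord 0) = ⟨[], tail_nil 0⟩ from Subsingleton.elim _ _]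
    simp [tailWeight, tailSum]
  | succ q ih =>
    -- A word either omits `q + 1` or begins with it.
    let φ : TailWord q ⊕ TailWord (q + 1) → TailWord (q + 1) :=
      Sum.elim (fun D => ⟨D.1, D.2.mono q.le_succ⟩) fun D => ⟨(q + 1) :: D.1, tail_cons_iff.2 D.2⟩
    have hφ : Function.Bijective φ := by
      constructor
      · refine Function.Injective.sumElim (fun D D' h => ?_) (fun D D' h => ?_) fun D D' h => ?_
        · have h := congrArg Subtype.val h
          exact Subtype.ext h
        · have h := congrArg Subtype.val h
          exact Subtype.ext (List.cons.inj h).2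
        · have h := congrArg Subtype.val h
          have := (D.2.2 (q + 1) (by simp [show D.1 = _ from h])).2
          omega
      · rintro ⟨D, hD⟩
        by_cases h : q + 1 ∈ D
        · cases D with
          | nil => simp at h
          | cons d D =>
            have hd : d = q + 1 := by
              have h1 := (hD.2 d (by simp)).2
              rcases List.mem_cons.1 h with h | h
              · exact h.symm
              · exact le_antisymm h1 ((List.pairwise_cons.1 hD.1).1 _ h)
            subst hd
            exact ⟨Sum.inr ⟨D, tail_cons_iff.1 hD⟩, rfl⟩
        · refine ⟨Sum.inl ⟨D, hD.1, fun d hd => ⟨(hD.2 d hd).1, ?_⟩⟩, rfl⟩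
          have := (hD.2 d hd).2
          have : d ≠ q + 1 := fun h' => h (h' ▸ hd)
          omega
    -- Removing a leading `q + 1` keeps the last letter unless nothing remains; in that case the
    -- last letter was `q + 1`, hence the default `v ^ (q + 1)`.
    have key : ∀ e s, HasSum (fun D : TailWord (q + 1) => tailWeight v (v ^ (q + 1)) D.1) s →
        HasSum (fun D : TailWord (q + 1) => tailWeight v e D.1) (e + tailSum v q + X * s) := by
      intro e s hs
      rw [← (Equiv.ofBijective φ hφ).hasSum_iff]
      refine HasSum.sum (ih e) ((hs.mul_left X).congr_fun ?_)
      rintro ⟨D, hD⟩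
      simp only [Function.comp_apply, Equiv.ofBijective_apply, φ, Sum.elim_inr, tailWeight,
        List.getLast?_cons, List.length_cons]
      cases D.getLast? <;> simp <;> ring
    obtain ⟨s, hs⟩ : Summable fun D : TailWord (q + 1) => tailWeight v (v ^ (q + 1)) D.1 :=
      summable_X_pow_mul (fun D : TailWord (q + 1) => D.1.length)
        (fun n => finite_tailWord n _) _
    -- For the default `v ^ (q + 1)` the recursion refers to itself and determines `s`; any other
    -- `e` then follows from `key`.
    have h1 := hs.unique (key _ _ hs)
    have hy := inv_mul_one_sub_X
    have hs' : s = (1 - X)⁻¹ * (v ^ (q + 1) + tailSum v q) := by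
      linear_combination (1 - X : ℚ⟦X⟧)⁻¹ * h1 - s * hy
    have := key e s hs
    rw [hs'] at this
    convert this using 1
    rw [tailSum]
    ring

/-! ### Functional equations -/

/-- The generating function of `AvWord` by length and `stat`. -/
noncomputable def avGen (v : ℚ⟦X⟧) : ℚ⟦X⟧ := ∑' w : AvWord, X ^ w.1.length * v ^ stat w.1

/-- The generating function of `NcWord` by length and largest letter. -/
noncomputable def ncGen (v : ℚ⟦X⟧) : ℚ⟦X⟧ := ∑' w : NcWord, X ^ w.1.length * v ^ (bound w.1 - 1)

theorem hasSum_avGen (v : ℚ⟦X⟧) :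
    HasSum (fun w : AvWord => X ^ w.1.length * v ^ stat w.1) (avGen v) :=
  (summable_X_pow_mul (fun w : AvWord => w.1.length) finite_avWord _).hasSum

theorem hasSum_ncGen (v : ℚ⟦X⟧) :
    HasSum (fun w : NcWord => X ^ w.1.length * v ^ (bound w.1 - 1)) (ncGen v) :=
  (summable_X_pow_mul (fun w : NcWord => w.1.length) finite_ncWord _).hasSum

theorem grow_nil (m : ℕ) : Grow m [] := trivial

theorem nc_nil : Nc [] := by
  rintro a ⟨b, _, h⟩
  simp at h

/-- The decomposition of nonempty `101`-avoiding restricted growth words at the last `0`. -/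
noncomputable def ncBuild : Unit ⊕ NcWord ⊕ NcWord ⊕ NcWord × NcWord → NcWord :=
  Sum.elim (fun _ => ⟨build [] [] [], build_ne_nil _ _ _,
      grow_build (grow_nil 0) (grow_nil 0) (tail_nil _), nc_build nc_nil nc_nil⟩) <|
  Sum.elim (fun A => ⟨build [] A.1 [], build_ne_nil _ _ _,
      grow_build (grow_nil 0) A.2.2.1 (tail_nil _), nc_build nc_nil A.2.2.2⟩) <|
  Sum.elim (fun L => ⟨build L.1 [] [], build_ne_nil _ _ _,
      grow_build L.2.2.1 (grow_nil 0) (tail_nil _), nc_build L.2.2.2 nc_nil⟩) fun P =>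
    ⟨build P.1.1 P.2.1 [], build_ne_nil _ _ _,
      grow_build P.1.2.2.1 P.2.2.2.1 (tail_nil _), nc_build P.1.2.2.2 P.2.2.2.2⟩

theorem build_left_inj {L A L' A' : List ℕ} (h : build L A [] = build L' A' []) :
    L = L' ∧ A = A' := by
  have := build_inj (tail_nil _) (tail_nil _) h
  exact ⟨this.1, this.2.1⟩

theorem ncBuild_bijective : Function.Bijective ncBuild := by
  constructor
  · rintro (_ | ⟨A, hA⟩ | ⟨L, hL⟩ | ⟨⟨L, hL⟩, ⟨A, hA⟩⟩) (_ | ⟨A', hA'⟩ | ⟨L', hL'⟩ | ⟨⟨L', hL'⟩, ⟨A', hA'⟩⟩) h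
    all_goals
      have h := build_left_inj (congrArg Subtype.val h)
      obtain ⟨h1, h2⟩ := h
      subst_vars
      first
        | rfl
        | exact absurd rfl hA.1
        | exact absurd rfl hA'.1
        | exact absurd rfl hL.1
        | exact absurd rfl hL'.1
  · rintro ⟨w, hw, hg, hn⟩
    obtain ⟨L, A, D, rfl, hgL, hgA, -, -, hD, -, -⟩ := exists_build hw hg hn.av
    obtain ⟨hL, hA, rfl⟩ := nc_of_nc_build hgL hD hn
    rcases eq_or_ne L [] with rfl | hL' <;> rcases eq_or_ne A [] with rfl | hA'
    · exact ⟨Sum.inl (), rfl⟩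
    · exact ⟨Sum.inr (Sum.inl ⟨A, hA', hgA, hA⟩), rfl⟩
    · exact ⟨Sum.inr (Sum.inr (Sum.inl ⟨L, hL', hgL, hL⟩)), rfl⟩
    · exact ⟨Sum.inr (Sum.inr (Sum.inr (⟨L, hL', hgL, hL⟩, ⟨A, hA', hgA, hA⟩))), rfl⟩

/-- The two factors are the choices of `L` and `A`, each possibly empty. A nonempty `A` raises the
largest letter by one more than its own largest letter, hence the `v`. -/
theorem ncGen_eq (v : ℚ⟦X⟧) : ncGen v = X * (1 + ncGen v) * (1 + v * ncGen v) := by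
  have hG := hasSum_ncGen v
  have h := (Equiv.ofBijective _ ncBuild_bijective).hasSum_iff.2 hG
  have h' : HasSum ((fun w : NcWord => (X : ℚ⟦X⟧) ^ w.1.length * v ^ (bound w.1 - 1)) ∘
      Equiv.ofBijective _ ncBuild_bijective)
      (X + (X * v * ncGen v + (X * ncGen v + X * v * (ncGen v * ncGen v)))) := by
    refine HasSum.sum ?_ (HasSum.sum ?_ (HasSum.sum ?_ ?_))
    · convert hasSum_unique _ using 1
      · simp [ncBuild, build]
      · infer_instance
    · refine (hG.mul_left (X * v)).congr_fun ?_
      rintro ⟨A, hA⟩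
      have := bound_pos hA.1
      obtain ⟨b, hb⟩ : ∃ b, bound A = b + 1 := ⟨bound A - 1, by omega⟩
      simp [ncBuild, build_length, bound_build_nil, hb]
      ring
    · refine (hG.mul_left X).congr_fun ?_
      rintro ⟨L, hL⟩
      simp [ncBuild, build_length, bound_build hL.1 (tail_nil _)]
      ring
    · refine ((hasSum_mul_of_finite finite_ncWord finite_ncWord hG hG).mul_left (X * v)).congr_fun ?_
      rintro ⟨⟨L, hL⟩, ⟨A, hA⟩⟩
      have h1 := bound_pos hL.1
      have h2 := bound_pos hA.1
      have : bound L + bound A - 1 = (bound L - 1) + (bound A - 1) + 1 := by omega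
      simp [ncBuild, build_length, bound_build hL.1 (tail_nil _), this]
      ring
  linear_combination h.unique h'

/-- The decomposition of nonempty `1012`-avoiding restricted growth words at the last `0`. -/
noncomputable def avBuild : Unit ⊕ AvWord ⊕ (Σ L : AvWord, TailWord (stat L.1)) ⊕
    (Σ P : NcWord × AvWord, TailWord (bound P.1.1 - 1)) → AvWord :=
  Sum.elim (fun _ => ⟨build [] [] [], build_ne_nil _ _ _,
      grow_build (grow_nil 0) (grow_nil 0) (tail_nil _), (nc_build nc_nil nc_nil).av⟩) <|
  Sum.elim (fun A => ⟨build [] A.1 [], build_ne_nil _ _ _,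
      grow_build (grow_nil 0) A.2.2.1 (tail_nil _), av_build_of_nc nc_nil A.2.2.2 (tail_nil _)⟩) <|
  Sum.elim (fun P => ⟨build P.1.1 [] P.2.1, build_ne_nil _ _ _,
      grow_build P.1.2.2.1 (grow_nil 0) (P.2.2.mono (stat_le _)),
      av_build_of_tail_stat P.1.2.2.2 P.2.2⟩) fun P =>
    ⟨build P.1.1.1 P.1.2.1 P.2.1, build_ne_nil _ _ _,
      grow_build P.1.1.2.2.1 P.1.2.2.2.1 P.2.2, av_build_of_nc P.1.1.2.2.2 P.1.2.2.2.2 P.2.2⟩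

theorem avBuild_bijective : Function.Bijective avBuild := by
  constructor
  · rintro (_ | ⟨A, hA⟩ | ⟨⟨L, hL⟩, ⟨D, hD⟩⟩ | ⟨⟨⟨L, hL⟩, ⟨A, hA⟩⟩, ⟨D, hD⟩⟩)
      (_ | ⟨A', hA'⟩ | ⟨⟨L', hL'⟩, ⟨D', hD'⟩⟩ | ⟨⟨⟨L', hL'⟩, ⟨A', hA'⟩⟩, ⟨D', hD'⟩⟩) h
    all_goals
      have h := build_inj (by first | exact tail_nil _ | exact hD | exact hD.mono (stat_le _))
        (by first | exact tail_nil _ | exact hD' | exact hD'.mono (stat_le _))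
        (congrArg Subtype.val h)
      obtain ⟨h1, h2, h3⟩ := h
      subst_vars
      first
        | rfl
        | exact absurd rfl hA.1
        | exact absurd rfl hA'.1
        | exact absurd rfl hL.1
        | exact absurd rfl hL'.1
  · rintro ⟨w, hw, hg, hav⟩
    obtain ⟨L, A, D, rfl, hgL, hgA, hL, hA, hD, hAL, hDL⟩ := exists_build hw hg hav
    rcases eq_or_ne L [] with rfl | hL' <;> rcases eq_or_ne A [] with rfl | hA'
    · obtain rfl := tail_zero.1 hD
      exact ⟨Sum.inl (), rfl⟩
    · obtain rfl := tail_zero.1 hD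
      exact ⟨Sum.inr (Sum.inl ⟨A, hA', hgA, hA⟩), rfl⟩
    · exact ⟨Sum.inr (Sum.inr (Sum.inl ⟨⟨L, hL', hgL, hL⟩, ⟨D, hDL rfl⟩⟩)), rfl⟩
    · exact ⟨Sum.inr (Sum.inr (Sum.inr
        ⟨(⟨L, hL', hgL, hAL hA'⟩, ⟨A, hA', hgA, hA⟩), ⟨D, hD⟩⟩)), rfl⟩

theorem X_pow_mul_pow_stat_build {L A D : List ℕ} (v : ℚ⟦X⟧) (hL : Grow 0 L)
    (hD : Tail (bound L - 1) D) (h : Av (build L A D)) :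
    X ^ (build L A D).length * v ^ stat (build L A D) =
      X * X ^ L.length * X ^ A.length * tailWeight v (v ^ stat (build L A [])) D := by
  rw [build_length, tailWeight]
  rcases eq_or_ne D [] with rfl | hne
  · simp only [List.length_nil, pow_zero, List.getLast?_nil, Option.elim_none]
    ring
  · rw [stat_build_of_tail hL hD hne h, List.getLast?_eq_some_getLast hne]
    simp
    ring

theorem stat_build_nil_nil_nil : stat (build [] [] []) = 0 := by
  have := stat_le (build [] [] [])
  rw [bound_build_nil] at this
  simpa using this

/-- Obtained by summing over `avBuild`, with the denominator of `tailSum` cleared by the factor `v -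
(1 - X)⁻¹`. A nonempty `D` alone determines `stat`, so `A` then contributes only its length, whence
`avGen 1`. -/
theorem avGen_eq (v : ℚ⟦X⟧) :
    (v - (1 - X)⁻¹) * avGen v =
      (v - (1 - X)⁻¹) * (X + X * v * avGen v + X * avGen v + X * v * ncGen v * avGen v) +
      X * ((1 - X)⁻¹ - 1) * v * (avGen v - avGen (1 - X)⁻¹) +
      X * ((1 - X)⁻¹ - 1) * v * (ncGen v - ncGen (1 - X)⁻¹) * avGen 1 := by
  set y : ℚ⟦X⟧ := (1 - X)⁻¹ with hy
  have hF := hasSum_avGen v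
  have h := (Equiv.ofBijective _ avBuild_bijective).hasSum_iff.2 (hF.mul_left (v - y))
  have h' : HasSum ((fun w : AvWord => (v - y) * ((X : ℚ⟦X⟧) ^ w.1.length * v ^ stat w.1)) ∘
      Equiv.ofBijective _ avBuild_bijective)
      ((v - y) * X + ((v - y) * X * v * avGen v +
        (((v - y) * X * avGen v + X * (y - 1) * v * (avGen v - avGen y)) +
        ((v - y) * X * v * (ncGen v * avGen v) +
          X * (y - 1) * v * ((ncGen v - ncGen y) * avGen 1))))) := by
    have hs : ∀ {κ : Type} (i : κ → AvWord), Function.Injective i →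
        Summable fun k => (v - y) * ((X : ℚ⟦X⟧) ^ (i k).1.length * v ^ stat (i k).1) :=
      fun i hi => (summable_X_pow_mul (fun k => (i k).1.length)
        (fun n => (finite_avWord n).preimage hi.injOn) _).mul_left _
    refine HasSum.sum ?_ (HasSum.sum ?_ (HasSum.sum ?_ ?_))
    · convert hasSum_unique _ using 1
      · simp [avBuild, build_length, stat_build_nil_nil_nil]
      · infer_instance
    · refine (hF.mul_left ((v - y) * X * v)).congr_fun ?_
      rintro ⟨A, hA⟩
      simp [avBuild, build_length, stat_build_of_nc nc_nil hA.1]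
      ring
    · refine HasSum.sigma_of_hasSum (g := fun L : AvWord => (v - y) * X * X ^ L.1.length *
        (v ^ stat L.1 + tailSum v (stat L.1))) ?_ ?_ ?_
      · refine ((hF.mul_left ((v - y) * X)).add
          ((hF.sub (hasSum_avGen y)).mul_left (X * (y - 1) * v))).congr_fun fun L => ?_
        have := tailSum_closed v (stat L.1)
        rw [← hy] at this
        linear_combination X * X ^ L.1.length * this
      · rintro ⟨L, hL⟩
        refine ((hasSum_tailWeight v (v ^ stat L) (stat L)).mul_left
          ((v - y) * X * X ^ L.length)).congr_fun ?_
        rintro ⟨D, hD⟩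
        have hD' := hD.mono (stat_le _)
        simp only [Function.comp_apply, Equiv.ofBijective_apply, avBuild, Sum.elim_inr,
          Sum.elim_inl]
        rw [X_pow_mul_pow_stat_build v hL.2.1 hD' (av_build_of_tail_stat hL.2.2 hD),
          stat_build_nil_nil hL.1]
        simp
        ring
      · exact hs _ (avBuild_bijective.1.comp
          (Sum.inr_injective.comp (Sum.inr_injective.comp Sum.inl_injective)))
    · refine HasSum.sigma_of_hasSum (g := fun P : NcWord × AvWord =>
        (v - y) * X * X ^ P.1.1.length * X ^ P.2.1.length *
        (v ^ (bound P.1.1 + stat P.2.1) + tailSum v (bound P.1.1 - 1))) ?_ ?_ ?_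
      · rw [sub_mul (ncGen v)]
        refine (((hasSum_mul_of_finite finite_ncWord finite_avWord (hasSum_ncGen v) hF).mul_left
          ((v - y) * X * v)).add
          ((((hasSum_mul_of_finite finite_ncWord finite_avWord (hasSum_ncGen v)
            (hasSum_avGen 1)).sub (hasSum_mul_of_finite finite_ncWord finite_avWord
            (hasSum_ncGen y) (hasSum_avGen 1))).mul_left (X * (y - 1) * v)))).congr_fun fun P => ?_
        have := tailSum_closed v (bound P.1.1 - 1)
        rw [← hy] at this
        have hb : bound P.1.1 + stat P.2.1 = (bound P.1.1 - 1) + stat P.2.1 + 1 := by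
          have := bound_pos P.1.2.1
          omega
        rw [hb]
        linear_combination X * X ^ P.1.1.length * X ^ P.2.1.length * this
      · rintro ⟨⟨L, hL⟩, ⟨A, hA⟩⟩
        refine ((hasSum_tailWeight v (v ^ (bound L + stat A)) (bound L - 1)).mul_left
          ((v - y) * X * X ^ L.length * X ^ A.length)).congr_fun ?_
        rintro ⟨D, hD⟩
        simp only [Function.comp_apply, Equiv.ofBijective_apply, avBuild, Sum.elim_inr]
        rw [X_pow_mul_pow_stat_build v hL.2.1 hD (av_build_of_nc hL.2.2 hA.2.2 hD),
          stat_build_of_nc hL.2.2 hA.1, max_eq_right (bound_pos hL.1)]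
        ring
      · exact hs _ (avBuild_bijective.1.comp
          (Sum.inr_injective.comp (Sum.inr_injective.comp Sum.inr_injective)))
  linear_combination h.unique h'

/-! ### Kernel method -/

theorem X_mul_inv_ne_zero : (X * (1 - X)⁻¹ : ℚ⟦X⟧) ≠ 0 := by
  refine mul_ne_zero X_ne_zero fun h => ?_
  have := inv_mul_one_sub_X
  rw [h, zero_mul] at this
  exact zero_ne_one this

/-- The difference of two solutions is annihilated by a series with constant term 1. -/
theorem ncGen_unique {v L : ℚ⟦X⟧} (h : L = X * (1 + L) * (1 + v * L)) : ncGen v = L := by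
  have hG := ncGen_eq v
  set G := ncGen v
  have hne : (1 - X * (1 + v + v * (G + L)) : ℚ⟦X⟧) ≠ 0 := fun h => by
    have := congrArg constantCoeff h
    simp at this
  have : (G - L) * (1 - X * (1 + v + v * (G + L))) = 0 := by linear_combination hG - h
  exact sub_eq_zero.1 ((mul_eq_zero.1 this).resolve_right hne)

/-- Elimination of the catalytic variable by the kernel method. -/
theorem avGen_one {c : ℚ⟦X⟧} (hc : c = 1 + X * (1 - X)⁻¹ * c ^ 2) :
    avGen 1 = X * (1 - X)⁻¹ * c := by
  have hz0 := X_mul_inv_ne_zero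
  have hy := inv_mul_one_sub_X
  have h1 := avGen_eq 1
  have h2 := avGen_eq (1 + X * (1 - X)⁻¹ * c)
  set y : ℚ⟦X⟧ := (1 - X)⁻¹
  obtain ⟨z, hz⟩ : ∃ z, z = X * y := ⟨_, rfl⟩
  have hyz : y = 1 + z := by linear_combination hy - hz
  rw [← hz] at hc h2 hz0 ⊢
  have hXz : X * (1 + z) = z := by rw [← hyz, hz]
  have hV : (1 + z * c) * (1 + z * c)⁻¹ = 1 := PowerSeries.mul_inv_cancel _ (by simp [hz])
  have hVne : (1 + z * c) ≠ 0 := left_ne_zero_of_mul_eq_one hV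
  have hN : (1 + z * c) * (1 + ncGen (1 + z * c)) = (1 + z) * c := by
    -- The claimed value of `ncGen (1 + z * c)`, obtained by solving the goal for it; it suffices to
    -- check the quadratic equation.
    obtain ⟨L, hL⟩ : ∃ L, L = (1 + z) * c * (1 + z * c)⁻¹ - 1 := ⟨_, rfl⟩
    have h3 : (1 + z * c) * (1 + L) = (1 + z) * c := by
      rw [hL]
      linear_combination (1 + z) * c * hV
    have h4 : (1 + z * c) * L = z * c ^ 2 := by linear_combination h3 + hc
    rw [ncGen_unique (mul_left_cancel₀ hVne (b := L) ?_), h3]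
    calc (1 + z * c) * L = X * (1 + z) * c * (1 + z * c ^ 2) := by
          rw [h4, ← hc, hXz]
          ring
      _ = X * ((1 + z * c) * (1 + L)) * (1 + (1 + z * c) * L) := by
          rw [h3, h4]
          ring
      _ = _ := by ring
  clear_value y
  subst hyz
  set F₁ := avGen 1
  set N := ncGen (1 + z * c)
  -- This says that the total coefficient of `avGen v` in `avGen_eq` vanishes at `v = 1 + z * c`.
  have kernel : (1 + z * c - (1 + z)) * (1 - X - X * ((1 + z * c) * (1 + N))) =
      X * z * (1 + z * c) := by
    rw [hN]
    linear_combination z * hc - z * c * hXz - (1 + z * c - (1 + z)) * c * hXz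
  have h1' : F₁ = X + X * F₁ + X * avGen (1 + z) + X * ncGen (1 + z) * F₁ := by
    refine mul_left_cancel₀ hz0 ?_
    linear_combination -h1
  have h2' : X * ((1 + z * c - (1 + z)) - z * (1 + z * c) * avGen (1 + z) +
      z * (1 + z * c) * (N - ncGen (1 + z)) * F₁) = 0 := by
    linear_combination avGen (1 + z * c) * kernel - h2
  have h3 := (mul_eq_zero.1 h2').resolve_left X_ne_zero
  -- Both relations contain `avGen (1 + z)` and `ncGen (1 + z)` only through `avGen (1 + z) + ncGen
  -- (1 + z) * F₁`, so both unknowns are eliminated at once.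
  refine mul_left_cancel₀ hz0 ?_
  linear_combination -X * h3 + z * (1 + z * c) * h1' + X * z * F₁ * hN + z * F₁ * c * hXz +
    z * c * hXz

/-! ### Catalan series at X/(1-X) and coefficient extraction -/

/-- The power series with coefficients `∑ i, (n - 1).choose i * catalan i`. -/
noncomputable def catalanTransform : ℚ⟦X⟧ :=
  (catalanSeries.map (Nat.castRingHom ℚ)).subst (X * (1 - X)⁻¹ : ℚ⟦X⟧)

theorem hasSubst_X_mul_inv : HasSubst (X * (1 - X)⁻¹ : ℚ⟦X⟧) :=
  HasSubst.of_constantCoeff_zero' (by simp)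

theorem catalanTransform_eq :
    catalanTransform = 1 + X * (1 - X)⁻¹ * catalanTransform ^ 2 := by
  have h := congrArg (PowerSeries.map (Nat.castRingHom ℚ)) catalanSeries_sq_mul_X_add_one
  simp only [map_add, map_mul, map_pow, map_one, PowerSeries.map_X] at h
  have h := congrArg (substAlgHom (R := ℚ) hasSubst_X_mul_inv) h
  simp only [map_add, map_mul, map_pow, map_one, substAlgHom_X] at h
  rw [coe_substAlgHom] at h
  change catalanTransform ^ 2 * _ + 1 = catalanTransform at h
  linear_combination -h

theorem one_sub_X_inv_pow_succ (d : ℕ) :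
    ((1 - X : ℚ⟦X⟧)⁻¹) ^ (d + 1) = mk fun n => (Nat.choose (d + n) d : ℚ) := by
  rw [← mk_one_pow_eq_mk_choose_add]
  congr 1
  rw [PowerSeries.inv_eq_iff_mul_eq_one (by simp)]
  exact mk_one_mul_one_sub_eq_one ℚ

theorem coeff_X_mul_inv_mul_catalanTransform {n : ℕ} (hn : 1 ≤ n) :
    coeff n (X * (1 - X)⁻¹ * catalanTransform) =
      ((∑ i ∈ Finset.range n, (n - 1).choose i * catalan i : ℕ) : ℚ) := by
  have h : X * (1 - X)⁻¹ * catalanTransform =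
      -- Absorbing the prefactor into the substituted series leaves only positive powers of X/(1-X),
      -- whose coefficients are single binomials.
      (X * catalanSeries.map (Nat.castRingHom ℚ)).subst (X * (1 - X)⁻¹ : ℚ⟦X⟧) := by
    rw [subst_mul hasSubst_X_mul_inv, subst_X hasSubst_X_mul_inv, catalanTransform]
  obtain ⟨m, rfl⟩ : ∃ m, n = m + 1 := ⟨n - 1, by omega⟩
  have hcoeff : ∀ i, coeff (m + 1) ((X * (1 - X)⁻¹ : ℚ⟦X⟧) ^ (i + 1)) = (m.choose i : ℚ) := by
    intro i
    rw [mul_pow, one_sub_X_inv_pow_succ, coeff_X_pow_mul']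
    split_ifs with hi
    · rw [coeff_mk]
      congr 2
      omega
    · rw [Nat.choose_eq_zero_of_lt (by omega), Nat.cast_zero]
  rw [h, coeff_subst' hasSubst_X_mul_inv, finsum_eq_sum_of_support_subset (s := Finset.range (m + 2))]
  · rw [Finset.sum_range_succ']
    simp only [hcoeff, coeff_succ_X_mul, coeff_map, catalanSeries_coeff]
    simp [mul_comm]
  · intro d hd
    rw [Function.mem_support] at hd
    rw [Finset.coe_range, Set.mem_Iio]
    by_contra! hlt
    obtain ⟨i, rfl⟩ : ∃ i, d = i + 1 := ⟨d - 1, by omega⟩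
    rw [hcoeff, Nat.choose_eq_zero_of_lt (by omega)] at hd
    simp at hd

theorem coeff_avGen_one {n : ℕ} (hn : 1 ≤ n) :
    coeff n (avGen 1) = (numAvoiders [1, 0, 1, 2] n : ℚ) := by
  have hfin : {w : AvWord | w.1.length = n}.Finite :=
    (finite_avWord (n + 1)).subset fun w hw => Nat.lt_succ_of_le (le_of_eq hw)
  have h := (PowerSeries.WithPiTopology.hasSum_iff_hasSum_coeff ℚ).1 (hasSum_avGen 1) n
  have h' : HasSum (fun w : AvWord => coeff n ((X : ℚ⟦X⟧) ^ w.1.length * 1 ^ stat w.1))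
      (∑ w ∈ hfin.toFinset, coeff n ((X : ℚ⟦X⟧) ^ w.1.length * 1 ^ stat w.1)) := by
    refine hasSum_sum_of_ne_finset_zero fun w hw => ?_
    have : n ≠ w.1.length := by simpa [eq_comm] using hw
    simp [coeff_X_pow, this]
  have himage : avoiders [1, 0, 1, 2] n = Subtype.val '' {w : AvWord | w.1.length = n} := by
    ext w
    rw [mem_avoiders_iff]
    constructor
    · rintro ⟨hl, hg, hav⟩
      exact ⟨⟨w, List.ne_nil_of_length_pos (by omega), hg, hav⟩, hl, rfl⟩
    · rintro ⟨w, hl, rfl⟩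
      exact ⟨hl, w.2.2⟩
  rw [h.unique h', numAvoiders, himage, Set.ncard_image_of_injective _ Subtype.val_injective,
    Set.ncard_eq_toFinset_card _ hfin, Finset.card_eq_sum_ones, Nat.cast_sum]
  refine Finset.sum_congr rfl fun w hw => ?_
  have : w.1.length = n := by simpa using hw
  simp [this]

end AscentSeq

theorem theorem3 :
    (∀ n : ℕ, 1 ≤ n →
      AscentSeq.numAvoiders [1, 0, 1, 2] n =
        ∑ i ∈ Finset.range n, (n - 1).choose i * catalan i) ∧
    (∃ S : PowerSeries ℚ,
      AscentSeq.IsSqrt S ((1 - 5 * PowerSeries.X) * (1 - PowerSeries.X)⁻¹) ∧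
      AscentSeq.genFun [1, 0, 1, 2] = PowerSeries.C (1 / 2 : ℚ) * (1 - S)) := by
  have hc := AscentSeq.catalanTransform_eq
  have hF := AscentSeq.avGen_one hc
  have hcoeff := @AscentSeq.coeff_avGen_one
  rw [hF] at hcoeff
  -- With z = X/(1-X), the witness is S = 1 - 2zc; from c = 1 + z c^2 one gets S^2 = 1 - 4z =
  -- (1-5X)/(1-X).
  refine ⟨fun n hn => ?_, 1 - 2 * (PowerSeries.X * (1 - PowerSeries.X)⁻¹ *
    AscentSeq.catalanTransform), ⟨by simp, ?_⟩, ?_⟩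
  · have := hcoeff hn
    rw [AscentSeq.coeff_X_mul_inv_mul_catalanTransform hn] at this
    exact_mod_cast this.symm
  · have hy := AscentSeq.inv_mul_one_sub_X
    linear_combination -4 * (PowerSeries.X * (1 - PowerSeries.X)⁻¹) * hc - hy
  · have h2 : PowerSeries.C (1 / 2 : ℚ) * 2 = 1 := by
      rw [show (2 : PowerSeries ℚ) = PowerSeries.C 2 from (map_ofNat PowerSeries.C 2).symm, ← map_mul]
      norm_num
    have : PowerSeries.C (1 / 2 : ℚ) * (1 - (1 - 2 * (PowerSeries.X * (1 - PowerSeries.X)⁻¹ *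
        AscentSeq.catalanTransform))) =
        PowerSeries.X * (1 - PowerSeries.X)⁻¹ * AscentSeq.catalanTransform := by
      linear_combination (PowerSeries.X * (1 - PowerSeries.X)⁻¹ * AscentSeq.catalanTransform) * h2
    rw [this]
    ext n
    rw [AscentSeq.genFun, PowerSeries.coeff_mk]
    split_ifs with hn
    · simp [hn]
    · exact (hcoeff (Nat.one_le_iff_ne_zero.2 hn)).symm
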